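/- For a set $A$ of positive integers and integers $i,n\ge 0$, let $c_A(i,n)$ be the number of compositions of $n$ with exactly $i$ parts, all of which belong to $A$ (that is, the number of $i$-tuples $(a_1,\dots,a_i)\in A^i$ with $a_1+\cdots+a_i=n$). For $k\ge 0$ put $$S_{A,k}(n)=\sum_{i=0}^{n}(-1)^i\, i^k\, c_A(i,n),$$ with the convention $0^0=1$. If $A=\{2,3\}$ or $A=\{1,4\}$, then the sequence $(\operatorname{sign}(S_{A,0}(n)))_{n\ge 0}$, where $\operatorname{sign}$ takes the values $-1,0,1$, is not eventually periodic; that is, there are no integers $p\ge 1$ and $N\ge 0$ such that $\operatorname{sign}(S_{A,0}(n+p))=\operatorname{sign}(S_{A,0}(n))$ for all $n\ge N$. -/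

import Mathlib

/-- `compCount A i n` is the number of compositions of `n` with exactly `i` parts, all of which
belong to `A`. -/
noncomputable def compCount (A : Set ℕ) (i n : ℕ) : ℕ :=
  Nat.card {c : Composition n // c.length = i ∧ ∀ a ∈ c.blocks, a ∈ A}

/-- `S_{A,k}(n) = ∑_{i=0}^{n} (-1)^i i^k c_A(i,n)`, with `0 ^ 0 = 1`. -/
noncomputable def compSum (A : Set ℕ) (k n : ℕ) : ℤ :=
  ∑ i ∈ Finset.range (n + 1), (-1 : ℤ) ^ i * (i : ℤ) ^ k * (compCount A i n : ℤ)

/-- A sequence is eventually periodic if, from some index on, it is invariant under a shift by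
some positive period. -/
def EventuallyPeriodic {α : Type*} (u : ℕ → α) : Prop :=
  ∃ p : ℕ, 0 < p ∧ ∃ N : ℕ, ∀ n : ℕ, N ≤ n → u (n + p) = u n

/-!
The sequence `s n = compSum A 0 n` has generating function `1 / (1 + ∑ a ∈ A, x ^ a)`, so for
`A = {2, 3}` and `A = {1, 4}` it satisfies the linear recurrence with characteristic polynomial
`x ^ 3 + x + 1`, respectively `x ^ 4 + x ^ 3 + 1`, and is a combination of powers of the roots.
In both cases the roots of largest absolute value are one non-real pair `ρ`, `conj ρ`, and
`s n / ‖ρ‖ ^ n` is `2 * re (c * u ^ n)`, with `u = ρ / ‖ρ‖`, up to a summable error.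

Suppose the signs have period `p` from some index on. If `u ^ p ≠ 1`, then along each residue class
modulo `p` the partial sums of `s n / ‖ρ‖ ^ n` are bounded, being geometric sums plus a summable
error; as the sign is constant, the terms tend to `0`. So `re (c * u ^ n)` tends to `0` along two
consecutive residue classes, which is impossible for a non-real `u` on the unit circle. Hence
`ρ ^ p = conj ρ ^ p` (`exists_pow_eq_conj_pow_of_sign_periodic`).

Any automorphism `g` of the field of algebraic numbers preserves this relation, so it maps `ρ`,
`conj ρ` to two distinct roots of the same absolute value, that is, to a conjugate pair of roots.
For the cubic, `g` thus fixes `ρ * conj ρ = ‖ρ‖ ^ 2`; for the quartic, whose two conjugate pairs have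
reciprocal products, it fixes `‖ρ‖ ^ 2 + 1 / ‖ρ‖ ^ 2`. A number fixed by all `g` is rational, and an
integral one is an integer (`exists_int_eq_aeval_of_pow_eq_conj_pow`). But these two numbers lie
strictly between `1` and `2`, respectively between `2` and `3`.
-/

/-! ### Compositions with prescribed parts -/

theorem compCount_zero_zero (A : Set ℕ) : compCount A 0 0 = 1 := by
  rw [compCount, Nat.card_eq_one_iff_unique]
  refine ⟨⟨fun c d => Subtype.ext (Composition.ext ?_)⟩, ⟨⟨default, ?_, ?_⟩⟩⟩
  · rw [List.length_eq_zero_iff.1 c.2.1, List.length_eq_zero_iff.1 d.2.1]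
  · exact Nat.le_zero.1 (Composition.length_le _)
  · intro a ha
    have h1 := Composition.blocks_pos _ ha
    have h2 := List.le_sum_of_mem ha
    rw [Composition.blocks_sum] at h2
    omega

theorem compCount_eq_zero_of_lt (A : Set ℕ) {i n : ℕ} (h : n < i) : compCount A i n = 0 := by
  rw [compCount, Nat.card_eq_zero]
  refine Or.inl ⟨fun c => ?_⟩
  have := c.1.length_le
  have := c.2.1
  omega

theorem compCount_zero_of_pos (A : Set ℕ) {n : ℕ} (h : 0 < n) : compCount A 0 n = 0 := by
  rw [compCount, Nat.card_eq_zero]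
  refine Or.inl ⟨fun c => ?_⟩
  have := c.1.length_pos_of_pos h
  have := c.2.1
  omega

open Classical in
/-- Splitting a composition into its first part and the rest. -/
theorem compCount_succ (A : Set ℕ) (i n : ℕ) :
    compCount A (i + 1) n = ∑ a ∈ Finset.Icc 1 n with a ∈ A, compCount A i (n - a) := by
  rw [← Finset.sum_coe_sort]
  simp only [compCount]
  rw [← Nat.card_sigma]
  symm
  let F : (Σ a : {a // a ∈ Finset.filter (· ∈ A) (Finset.Icc 1 n)},
      {c : Composition (n - a) // c.length = i ∧ ∀ b ∈ c.blocks, b ∈ A}) →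
      {c : Composition n // c.length = i + 1 ∧ ∀ b ∈ c.blocks, b ∈ A} := fun x =>
    ⟨⟨x.1.1 :: x.2.1.blocks, by
        intro b hb
        have h1 := (Finset.mem_Icc.1 (Finset.mem_filter.1 x.1.2).1).1
        rcases List.mem_cons.1 hb with rfl | hb
        · exact h1
        · exact x.2.1.blocks_pos hb, by
        have h1 := (Finset.mem_Icc.1 (Finset.mem_filter.1 x.1.2).1).2
        rw [List.sum_cons, x.2.1.blocks_sum]
        omega⟩, by
      have := x.2.2.1
      rw [← Composition.blocks_length] at this
      rw [← Composition.blocks_length, List.length_cons, this], by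
      intro b hb
      rcases List.mem_cons.1 hb with rfl | hb
      · exact (Finset.mem_filter.1 x.1.2).2
      · exact x.2.2.2 b hb⟩
  refine Nat.card_eq_of_bijective F ⟨?_, ?_⟩
  · rintro ⟨⟨a, ha⟩, ⟨c, hc⟩⟩ ⟨⟨b, hb⟩, ⟨d, hd⟩⟩ h
    have h' : a :: c.blocks = b :: d.blocks :=
      congrArg (fun z : {c : Composition n // c.length = i + 1 ∧ ∀ b ∈ c.blocks, b ∈ A} =>
        z.1.blocks) h
    obtain ⟨rfl, h2⟩ := List.cons.inj h'
    have : c = d := Composition.ext h2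
    subst this
    rfl
  · rintro ⟨⟨l, hpos, hsum⟩, hlen, hA⟩
    cases l with
    | nil => exact absurd hlen (Nat.succ_ne_zero i).symm
    | cons a l =>
      have ha : 0 < a := hpos List.mem_cons_self
      rw [List.sum_cons] at hsum
      refine ⟨⟨⟨a, ?_⟩, ⟨⟨l, fun h => hpos (List.mem_cons_of_mem _ h), ?_⟩, ?_, ?_⟩⟩, rfl⟩
      · rw [Finset.mem_filter, Finset.mem_Icc]
        exact ⟨⟨ha, by omega⟩, hA a List.mem_cons_self⟩
      · dsimp only
        omega
      · exact Nat.succ.inj hlen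
      · exact fun b hb => hA b (List.mem_cons_of_mem _ hb)

theorem compSum_zero_eq_sum_range (A : Set ℕ) {n M : ℕ} (h : n < M) :
    compSum A 0 n = ∑ i ∈ Finset.range M, (-1 : ℤ) ^ i * (compCount A i n : ℤ) := by
  simp only [compSum, pow_zero, mul_one]
  refine Finset.sum_subset (Finset.range_subset_range.2 h) fun i _ hi => ?_
  rw [compCount_eq_zero_of_lt A (by rw [Finset.mem_range] at hi; omega)]
  simp

theorem compSum_zero_zero (A : Set ℕ) : compSum A 0 0 = 1 := by
  simp [compSum, compCount_zero_zero]

open Classical in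
/-- The recurrence expressing that `compSum A 0` has generating function
`1 / (1 + ∑ a ∈ A, x ^ a)`. -/
theorem compSum_zero_of_pos {A : Set ℕ} {n : ℕ} (hn : 0 < n) {T : Finset ℕ}
    (hT : ∀ a, a ∈ T ↔ (1 ≤ a ∧ a ≤ n) ∧ a ∈ A) :
    compSum A 0 n = -∑ a ∈ T, compSum A 0 (n - a) := by
  have hT' : Finset.filter (· ∈ A) (Finset.Icc 1 n) = T := by
    ext a
    rw [Finset.mem_filter, Finset.mem_Icc, hT]
  have h : ∀ a ∈ T, compSum A 0 (n - a) =
      ∑ i ∈ Finset.range n, (-1 : ℤ) ^ i * (compCount A i (n - a) : ℤ) := fun a ha =>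
    compSum_zero_eq_sum_range A (by
      have := (hT a).1 ha
      omega)
  rw [Finset.sum_congr rfl h, Finset.sum_comm, compSum_zero_eq_sum_range A (Nat.lt_succ_self n),
    Finset.sum_range_succ', compCount_zero_of_pos A hn, ← Finset.sum_neg_distrib]
  simp only [compCount_succ, hT', Nat.cast_sum, pow_succ, Finset.mul_sum]
  simp

theorem compSum_two_three (n : ℕ) :
    compSum {2, 3} 0 (n + 3) = -compSum {2, 3} 0 (n + 1) - compSum {2, 3} 0 n := by
  rw [compSum_zero_of_pos (T := {2, 3}) (by omega) (by intro a; simp; omega),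
    Finset.sum_pair (by norm_num)]
  simp only [Nat.add_sub_cancel, show n + 3 - 2 = n + 1 by omega]
  ring

theorem compSum_one_four (n : ℕ) :
    compSum {1, 4} 0 (n + 4) = -compSum {1, 4} 0 (n + 3) - compSum {1, 4} 0 n := by
  rw [compSum_zero_of_pos (T := {1, 4}) (by omega) (by intro a; simp; omega),
    Finset.sum_pair (by norm_num)]
  simp only [Nat.add_sub_cancel, show n + 4 - 1 = n + 3 by omega]
  ring

theorem compSum_two_three_one : compSum {2, 3} 0 1 = 0 := by
  rw [compSum_zero_of_pos (T := ∅) one_pos (by intro a; simp; omega), Finset.sum_empty, neg_zero]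

theorem compSum_two_three_two : compSum {2, 3} 0 2 = -1 := by
  rw [compSum_zero_of_pos (T := {2}) two_pos (by intro a; simp; omega), Finset.sum_singleton,
    Nat.sub_self, compSum_zero_zero]

/-- Below `4` only the part `1` is available, so the all-ones composition is the only one. -/
theorem compSum_one_four_of_lt {n : ℕ} (hn : n < 4) : compSum {1, 4} 0 n = (-1) ^ n := by
  induction n with
  | zero => exact compSum_zero_zero _
  | succ n ih =>
    rw [compSum_zero_of_pos (T := {1}) (by omega) (by simp; omega), Finset.sum_singleton,
      Nat.add_sub_cancel, ih (by omega), pow_succ]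
    ring

/-! ### Sign patterns of oscillating sequences -/

open Filter Topology in
/-- A sequence of constant sign which is the sum of a geometric sequence with ratio on the unit
circle, different from `1`, and of a summable error has bounded partial sums, hence is itself
absolutely summable; so the geometric part has real part tending to `0`. -/
theorem tendsto_re_geometric_of_constant_sign {z w : ℂ} (hw : ‖w‖ = 1) (hw1 : w ≠ 1)
    {t ε : ℕ → ℝ} (hε : Summable ε) (ht : ∀ j, t j = (z * w ^ j).re + ε j)
    {σ : SignType} (hσ : ∀ j, SignType.sign (t j) = σ) :
    Tendsto (fun j => (z * w ^ j).re) atTop (𝓝 0) := by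
  have habs : ∀ j, |t j| = (σ : ℝ) * t j := fun j => by rw [← hσ j, sign_mul_self]
  have hgeom : ∀ J, |∑ j ∈ Finset.range J, (z * w ^ j).re| ≤ ‖z‖ * (2 / ‖w - 1‖) := by
    intro J
    rw [← Complex.re_sum, ← Finset.mul_sum, geom_sum_eq hw1]
    refine (Complex.abs_re_le_norm _).trans ?_
    rw [norm_mul, norm_div]
    gcongr
    refine (norm_sub_le _ _).trans ?_
    rw [norm_pow, hw, one_pow, norm_one]
    norm_num
  have hσ1 : |(σ : ℝ)| ≤ 1 := by cases σ <;> simp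
  have hsum : Summable fun j => |t j| := by
    refine summable_of_sum_range_le (c := ‖z‖ * (2 / ‖w - 1‖) + ∑' j, |ε j|)
      (fun _ => abs_nonneg _) fun J => ?_
    simp only [habs]
    rw [← Finset.mul_sum]
    refine (le_abs_self _).trans ?_
    rw [abs_mul]
    refine (mul_le_of_le_one_left (abs_nonneg _) hσ1).trans ?_
    simp only [ht, Finset.sum_add_distrib]
    refine (abs_add_le _ _).trans (add_le_add (hgeom J) ?_)
    exact (Finset.abs_sum_le_sum_abs _ _).trans (hε.abs.sum_le_tsum _ fun _ _ => abs_nonneg _)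
  have h := hsum.of_abs.tendsto_atTop_zero.sub hε.tendsto_atTop_zero
  simpa [ht] using h

open Filter Topology ComplexConjugate in
/-- If a real sequence is dominated by the contribution of a conjugate pair `ρ`, `conj ρ` of
non-real numbers and its sign is eventually periodic, then some power of `ρ` is real. -/
theorem exists_pow_eq_conj_pow_of_sign_periodic {s : ℕ → ℤ} {ρ c : ℂ} {e : ℕ → ℂ}
    (hρ : ρ.im ≠ 0) (hc : c ≠ 0) (hs : ∀ n, (s n : ℂ) = c * ρ ^ n + conj (c * ρ ^ n) + e n)
    (he : Summable fun n => ‖e n‖ / ‖ρ‖ ^ n)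
    (h : EventuallyPeriodic fun n => SignType.sign (s n)) :
    ∃ p : ℕ, 0 < p ∧ ρ ^ p = conj ρ ^ p := by
  obtain ⟨p, hp, N, hN⟩ := h
  have hρ0 : ρ ≠ 0 := fun h0 => hρ (by simp [h0])
  have hn : 0 < ‖ρ‖ := norm_pos_iff.2 hρ0
  have hnC : (‖ρ‖ : ℂ) ≠ 0 := by exact_mod_cast hn.ne'
  set u : ℂ := ρ / ‖ρ‖ with hu
  have hun : ‖u‖ = 1 := by simp [hu, hn.ne']
  have hρu : ρ = ‖ρ‖ * u := by rw [hu]; field_simp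
  refine ⟨p, hp, ?_⟩
  by_cases hw1 : u ^ p = 1
  · have h1 : ρ ^ p = (‖ρ‖ : ℂ) ^ p := by
      conv_lhs => rw [hρu]
      rw [mul_pow, hw1, mul_one]
    rw [← map_pow, h1, map_pow, Complex.conj_ofReal]
  exfalso
  set t : ℕ → ℝ := fun n => s n / ‖ρ‖ ^ n with ht
  set ε : ℕ → ℝ := fun n => (e n).re / ‖ρ‖ ^ n with hε
  have hts : ∀ n, SignType.sign (t n) = SignType.sign (s n) := by
    intro n
    have : SignType.sign ((s n : ℝ)) = SignType.sign (s n) := by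
      rcases lt_trichotomy (s n) 0 with h | h | h
      · rw [sign_neg h, sign_neg (by exact_mod_cast h)]
      · simp [h]
      · rw [sign_pos h, sign_pos (by exact_mod_cast h)]
    rw [ht]
    simp only [div_eq_mul_inv]
    rw [sign_mul, this, sign_pos (by positivity : 0 < (‖ρ‖ ^ n)⁻¹), mul_one]
  have hεs : Summable ε := by
    refine Summable.of_norm_bounded he fun n => ?_
    rw [hε, Real.norm_eq_abs, abs_div, abs_of_pos (pow_pos hn n)]
    gcongr
    exact Complex.abs_re_le_norm _
  have htε : ∀ n, t n = (2 * c * u ^ n).re + ε n := by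
    intro n
    have h1 := congrArg Complex.re (hs n)
    simp only [Complex.intCast_re, Complex.add_re, Complex.conj_re] at h1
    have h2 : c * ρ ^ n = ((‖ρ‖ ^ n : ℝ) : ℂ) * (c * u ^ n) := by
      conv_lhs => rw [hρu]
      push_cast
      ring
    rw [h2, Complex.re_ofReal_mul] at h1
    have h3 : (2 * c * u ^ n).re = 2 * (c * u ^ n).re := by
      rw [mul_assoc, show (2 : ℂ) = ((2 : ℝ) : ℂ) by norm_num, Complex.re_ofReal_mul]
    simp only [ht, hε]
    rw [h1, h3]
    field_simp
    ring
  have hsgn : ∀ n, N ≤ n → ∀ j, SignType.sign (t (n + p * j)) = SignType.sign (s n) := by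
    intro n hn j
    rw [hts]
    induction j with
    | zero => simp
    | succ j ih => rw [← ih, mul_add, mul_one, ← add_assoc]; exact hN _ (by omega)
  have key : ∀ n, N ≤ n → Tendsto (fun j => (2 * c * u ^ n * (u ^ p) ^ j).re) atTop (𝓝 0) := by
    intro n hn
    refine tendsto_re_geometric_of_constant_sign (t := fun j => t (n + p * j))
      (ε := fun j => ε (n + p * j)) (by rw [norm_pow, hun, one_pow]) hw1 ?_ ?_ (hsgn n hn)
    · exact hεs.comp_injective fun a b hab => Nat.eq_of_mul_eq_mul_left hp (Nat.add_left_cancel hab)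
    · intro j
      rw [htε, pow_add, pow_mul, mul_assoc _ (u ^ n)]
  set z : ℕ → ℂ := fun j => 2 * c * u ^ N * (u ^ p) ^ j with hz
  have hre : Tendsto (fun j => (z j).re) atTop (𝓝 0) := key N le_rfl
  -- Multiplication by the non-real `u` turns the next residue class into control of `im z`.
  have hre' : Tendsto (fun j => u.re * (z j).re - u.im * (z j).im) atTop (𝓝 0) := by
    refine (key (N + 1) (Nat.le_succ N)).congr fun j => ?_
    rw [← Complex.mul_re, hz]
    ring_nf
  have huim : u.im ≠ 0 := by
    rw [hu, Complex.div_ofReal_im]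
    exact div_ne_zero hρ hn.ne'
  have him : Tendsto (fun j => (z j).im) atTop (𝓝 0) := by
    have h1 := ((hre.const_mul u.re).sub hre').const_mul u.im⁻¹
    simp only [mul_zero, sub_zero, sub_sub_cancel, inv_mul_cancel_left₀ huim] at h1
    exact h1
  have hnorm : ∀ j, (z j).re ^ 2 + (z j).im ^ 2 = (2 * ‖c‖) ^ 2 := by
    intro j
    have : ‖z j‖ = 2 * ‖c‖ := by simp [hz, hun]
    rw [← this, Complex.sq_norm, Complex.normSq_apply]
    ring
  have hlim := (hre.pow 2).add (him.pow 2)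
  simp only [hnorm] at hlim
  have h0 := tendsto_nhds_unique hlim tendsto_const_nhds
  have : 0 < ‖c‖ := norm_pos_iff.2 hc
  have : 0 < (2 * ‖c‖) ^ 2 := by positivity
  rw [← h0] at this
  norm_num at this

/-! ### Conjugate roots with a common power -/

theorem isGalois_algebraicClosure_rat_complex : IsGalois ℚ (algebraicClosure ℚ ℂ) := by
  -- Instance search finds for `algebraicClosure ℚ ℂ` the `ℚ`-algebra structure of a
  -- division ring of characteristic zero, while `algebraicClosure.isAlgClosure` is about that of
  -- an intermediate field.
  have : Normal ℚ (algebraicClosure ℚ ℂ) :=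
    @IsAlgClosure.normal ℚ (algebraicClosure ℚ ℂ) _ _ (algebraicClosure ℚ ℂ).algebra'
      (algebraicClosure.isAlgClosure ℚ ℂ)
  exact ⟨⟩

open ComplexConjugate Polynomial in
/-- If `ρ` and its complex conjugate have a common power, then so have their images under an
automorphism `g` of the field of algebraic numbers. These images are thus distinct roots of `f` of
the same absolute value, and `g (ρ * conj ρ)` is their product. So if `F` takes the same value at
all such products, then this value is fixed by all automorphisms, hence rational, and being
integral it is an integer. -/
theorem exists_int_eq_aeval_of_pow_eq_conj_pow {f F : ℤ[X]} {ρ : ℂ} {p : ℕ} (hp : 0 < p)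
    (hf : f.Monic) (hfρ : aeval ρ f = 0) (hρ : ρ.im ≠ 0) (hpow : ρ ^ p = conj ρ ^ p)
    (h : ∀ a b : ℂ, aeval a f = 0 → aeval b f = 0 → a ≠ b → ‖a‖ = ‖b‖ →
      aeval (a * b) F = aeval (ρ * conj ρ) F) :
    ∃ k : ℤ, aeval (ρ * conj ρ) F = k := by
  have hint : IsIntegral ℤ ρ := ⟨f, hf, by rwa [← aeval_def]⟩
  have hcint : IsIntegral ℤ (conj ρ) := hint.map (conj : ℂ →+* ℂ).toIntAlgHom
  have hx : IsIntegral ℤ (aeval (ρ * conj ρ) F) := by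
    let z : integralClosure ℤ ℂ := ⟨ρ * conj ρ, hint.mul hcint⟩
    rw [show ρ * conj ρ = (z : ℂ) from rfl, Subalgebra.aeval_coe]
    exact (aeval z F).2
  refine hx.exists_int_iff_exists_rat.1 ?_
  have := isGalois_algebraicClosure_rat_complex
  let r : algebraicClosure ℚ ℂ := ⟨ρ, mem_algebraicClosure_iff'.2 hint.tower_top⟩
  let r' : algebraicClosure ℚ ℂ := ⟨conj ρ, mem_algebraicClosure_iff'.2 hcint.tower_top⟩
  let ι : algebraicClosure ℚ ℂ →ₐ[ℤ] ℂ := (algebraMap (algebraicClosure ℚ ℂ) ℂ).toIntAlgHom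
  have hι : Function.Injective ι := (algebraMap (algebraicClosure ℚ ℂ) ℂ).injective
  have hr : ι r = ρ := rfl
  have hr' : ι r' = conj ρ := rfl
  have hfr : aeval r f = 0 := hι (by rw [← aeval_algHom_apply, hr, hfρ, map_zero])
  have hfr' : aeval r' f = 0 := by
    refine hι ?_
    rw [← aeval_algHom_apply, hr', map_zero]
    have := aeval_algHom_apply (conj : ℂ →+* ℂ).toIntAlgHom ρ f
    rw [hfρ, map_zero] at this
    exact this
  have hpow' : r ^ p = r' ^ p := hι (by rw [map_pow, map_pow, hr, hr', hpow])
  have hne : r ≠ r' := fun he => hρ (Complex.conj_eq_iff_im.1 (congrArg ι he).symm)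
  obtain ⟨q, hq⟩ := (InfiniteGalois.mem_range_algebraMap_iff_fixed (k := ℚ)
    (aeval (r * r') F)).2 fun g => by
      let γ : algebraicClosure ℚ ℂ →ₐ[ℤ] algebraicClosure ℚ ℂ :=
        (g : algebraicClosure ℚ ℂ →+* algebraicClosure ℚ ℂ).toIntAlgHom
      have hγ : Function.Injective γ := g.injective
      change γ _ = _
      refine hι ?_
      rw [← aeval_algHom_apply, ← aeval_algHom_apply, ← aeval_algHom_apply, map_mul, map_mul,
        map_mul, hr, hr']
      refine h _ _ ?_ ?_ ((hι.comp hγ).ne hne) ?_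
      · rw [aeval_algHom_apply, aeval_algHom_apply, hfr, map_zero, map_zero]
      · rw [aeval_algHom_apply, aeval_algHom_apply, hfr', map_zero, map_zero]
      · refine (pow_left_inj₀ (norm_nonneg _) (norm_nonneg _) hp.ne').1 ?_
        rw [← norm_pow, ← norm_pow, ← map_pow, ← map_pow, ← map_pow, ← map_pow, hpow']
  refine ⟨q, ?_⟩
  have h1 := congrArg ι hq
  rw [← aeval_algHom_apply, map_mul, hr, hr'] at h1
  rw [← h1]
  exact (map_ratCast (algebraMap (algebraicClosure ℚ ℂ) ℂ) q)

/-! ### Roots and closed forms -/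

/-- Lagrange interpolation of `x ^ k` at the nodes `a`, `b`, `c`: the sums `T k` are the leading
coefficients (at `x ^ 2`) of the interpolants. -/
theorem weighted_power_sums_three {K : Type*} [Field K] {a b c : K} (hab : a ≠ b) (hac : a ≠ c)
    (hbc : b ≠ c) {T : ℕ → K} (hT : ∀ k, T k = ((a - b) * (a - c))⁻¹ * a ^ k +
      ((b - a) * (b - c))⁻¹ * b ^ k + ((c - a) * (c - b))⁻¹ * c ^ k) :
    T 0 = 0 ∧ T 1 = 0 ∧ T 2 = 1 := by
  have h1 := sub_ne_zero.2 hab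
  have h2 := sub_ne_zero.2 hac
  have h3 := sub_ne_zero.2 hbc
  simp only [hT, ← neg_sub a b, ← neg_sub a c, ← neg_sub b c]
  refine ⟨?_, ?_, ?_⟩ <;> field_simp <;> ring

/-- Lagrange interpolation of `x ^ k` at four nodes, as in `weighted_power_sums_three`. -/
theorem weighted_power_sums_four {K : Type*} [Field K] {a b c d : K} (hab : a ≠ b) (hac : a ≠ c)
    (had : a ≠ d) (hbc : b ≠ c) (hbd : b ≠ d) (hcd : c ≠ d) {T : ℕ → K}
    (hT : ∀ k, T k = ((a - b) * (a - c) * (a - d))⁻¹ * a ^ k +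
      ((b - a) * (b - c) * (b - d))⁻¹ * b ^ k + ((c - a) * (c - b) * (c - d))⁻¹ * c ^ k +
      ((d - a) * (d - b) * (d - c))⁻¹ * d ^ k) :
    T 0 = 0 ∧ T 1 = 0 ∧ T 2 = 0 ∧ T 3 = 1 := by
  have h1 := sub_ne_zero.2 hab
  have h2 := sub_ne_zero.2 hac
  have h3 := sub_ne_zero.2 had
  have h4 := sub_ne_zero.2 hbc
  have h5 := sub_ne_zero.2 hbd
  have h6 := sub_ne_zero.2 hcd
  simp only [hT, ← neg_sub a b, ← neg_sub a c, ← neg_sub a d, ← neg_sub b c, ← neg_sub b d,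
    ← neg_sub c d]
  refine ⟨?_, ?_, ?_, ?_⟩ <;> field_simp <;> ring

open ComplexConjugate in
theorem exists_conj_roots_of_discrim_neg {P Q : ℝ} (h : P ^ 2 < 4 * Q) :
    ∃ ρ : ℂ, ρ.im ≠ 0 ∧ ρ + conj ρ = -P ∧ ρ * conj ρ = Q := by
  have h0 : 0 < Q - P ^ 2 / 4 := by linarith
  refine ⟨⟨-P / 2, √(Q - P ^ 2 / 4)⟩, (Real.sqrt_pos.2 h0).ne', ?_, ?_⟩
  · rw [Complex.add_conj]
    push_cast
    ring
  · rw [Complex.mul_conj, Complex.normSq_mk, Real.mul_self_sqrt h0.le]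
    congr 1
    ring

/-- Partial fractions for `1 / (1 + x ^ 2 + x ^ 3)`. -/
theorem compSum_two_three_closed_form {a b c : ℂ} (hab : a ≠ b) (hac : a ≠ c) (hbc : b ≠ c)
    (h : ∀ x : ℂ, x ^ 3 + x + 1 = (x - a) * (x - b) * (x - c)) (n : ℕ) :
    (compSum {2, 3} 0 n : ℂ) = ((a - b) * (a - c))⁻¹ * a ^ (n + 2) +
      ((b - a) * (b - c))⁻¹ * b ^ (n + 2) + ((c - a) * (c - b))⁻¹ * c ^ (n + 2) := by
  set T : ℕ → ℂ := fun k => ((a - b) * (a - c))⁻¹ * a ^ k +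
      ((b - a) * (b - c))⁻¹ * b ^ k + ((c - a) * (c - b))⁻¹ * c ^ k with hT
  obtain ⟨h0, h1, h2⟩ := weighted_power_sums_three hab hac hbc (T := T) fun _ => rfl
  have ha : a ^ 3 = -a - 1 := by linear_combination h a
  have hb : b ^ 3 = -b - 1 := by linear_combination h b
  have hc : c ^ 3 = -c - 1 := by linear_combination h c
  have hrec : ∀ k, T (k + 3) = -T (k + 1) - T k := by
    intro k
    simp only [hT, pow_add, ha, hb, hc]
    ring
  change _ = T (n + 2)
  induction n using Nat.strong_induction_on with
  | _ n ih =>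
    match n with
    | 0 => rw [compSum_zero_zero, h2, Int.cast_one]
    | 1 => rw [compSum_two_three_one, hrec, h0, h1]; simp
    | 2 => rw [compSum_two_three_two, hrec, h1, h2]; simp
    | n + 3 =>
      rw [compSum_two_three, show n + 3 + 2 = n + 2 + 3 by omega, hrec]
      push_cast
      rw [ih (n + 1) (by omega), ih n (by omega)]

/-- Partial fractions for `1 / (1 + x + x ^ 4)`. -/
theorem compSum_one_four_closed_form {a b c d : ℂ} (hab : a ≠ b) (hac : a ≠ c) (had : a ≠ d)
    (hbc : b ≠ c) (hbd : b ≠ d) (hcd : c ≠ d)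
    (h : ∀ x : ℂ, x ^ 4 + x ^ 3 + 1 = (x - a) * (x - b) * (x - c) * (x - d)) (n : ℕ) :
    (compSum {1, 4} 0 n : ℂ) = ((a - b) * (a - c) * (a - d))⁻¹ * a ^ (n + 3) +
      ((b - a) * (b - c) * (b - d))⁻¹ * b ^ (n + 3) +
      ((c - a) * (c - b) * (c - d))⁻¹ * c ^ (n + 3) +
      ((d - a) * (d - b) * (d - c))⁻¹ * d ^ (n + 3) := by
  set T : ℕ → ℂ := fun k => ((a - b) * (a - c) * (a - d))⁻¹ * a ^ k +
      ((b - a) * (b - c) * (b - d))⁻¹ * b ^ k + ((c - a) * (c - b) * (c - d))⁻¹ * c ^ k +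
      ((d - a) * (d - b) * (d - c))⁻¹ * d ^ k with hT
  obtain ⟨h0, h1, h2, h3⟩ :=
    weighted_power_sums_four hab hac had hbc hbd hcd (T := T) fun _ => rfl
  have ha : a ^ 4 = -a ^ 3 - 1 := by linear_combination h a
  have hb : b ^ 4 = -b ^ 3 - 1 := by linear_combination h b
  have hc : c ^ 4 = -c ^ 3 - 1 := by linear_combination h c
  have hd : d ^ 4 = -d ^ 3 - 1 := by linear_combination h d
  have hrec : ∀ k, T (k + 4) = -T (k + 3) - T k := by
    intro k
    simp only [hT, pow_add _ k 4, ha, hb, hc, hd]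
    ring
  change _ = T (n + 3)
  have h4 : T 4 = -1 := by rw [hrec 0, h0, h3]; simp
  have h5 : T 5 = 1 := by rw [hrec 1, h1, h4]; simp
  have h6 : T 6 = -1 := by rw [hrec 2, h2, h5]; simp
  induction n using Nat.strong_induction_on with
  | _ n ih =>
    match n with
    | 0 => rw [compSum_one_four_of_lt (by omega), h3]; simp
    | 1 => rw [compSum_one_four_of_lt (by omega), h4]; simp
    | 2 => rw [compSum_one_four_of_lt (by omega), h5]; simp
    | 3 => rw [compSum_one_four_of_lt (by omega), h6]; norm_num
    | n + 4 =>
      rw [compSum_one_four, show n + 4 + 3 = n + 3 + 4 by omega, hrec]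
      push_cast
      rw [ih (n + 3) (by omega), ih n (by omega)]

theorem summable_norm_div_pow {e : ℕ → ℂ} {K κ R : ℝ} (hκ : 0 ≤ κ) (hR : κ < R)
    (h : ∀ n, ‖e n‖ ≤ K * κ ^ n) : Summable fun n => ‖e n‖ / R ^ n := by
  have hR0 : 0 < R := hκ.trans_lt hR
  have hg : Summable fun n : ℕ => K * (κ / R) ^ n :=
    (summable_geometric_of_lt_one (by positivity) ((div_lt_one hR0).2 hR)).mul_left K
  refine hg.of_nonneg_of_le (fun n => by positivity) fun n => ?_
  rw [div_pow, ← mul_div_assoc]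
  gcongr
  exact h n

open ComplexConjugate in
theorem ne_conj_of_im_ne_zero {z : ℂ} (h : z.im ≠ 0) : z ≠ conj z :=
  fun he => h (Complex.conj_eq_iff_im.1 he.symm)

open ComplexConjugate in
theorem norm_sq_eq_of_mul_conj_eq {z : ℂ} {Q : ℝ} (h : z * conj z = Q) : ‖z‖ ^ 2 = Q := by
  rw [Complex.mul_conj'] at h
  exact_mod_cast h

open ComplexConjugate in
/-- The real root `α` of `x ^ 3 + x + 1` lies in `(-1, 0)`, and the complex roots `ρ`, `conj ρ`
have absolute value `√(α ^ 2 + 1)`. -/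
theorem exists_roots_cubic : ∃ (α : ℝ) (ρ : ℂ), -1 < α ∧ α < 0 ∧ ρ.im ≠ 0 ∧
    ρ * conj ρ = (α ^ 2 + 1 : ℝ) ∧
    ∀ x : ℂ, x ^ 3 + x + 1 = (x - ρ) * (x - conj ρ) * (x - α) := by
  have hcont : ContinuousOn (fun x : ℝ => x ^ 3 + x + 1) (Set.Icc (-1) 0) := by fun_prop
  obtain ⟨α, ⟨h1, h2⟩, h3⟩ :=
    intermediate_value_Ioo (by norm_num : (-1 : ℝ) ≤ 0) hcont ⟨(by norm_num : _ < (0 : ℝ)),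
      (by norm_num : (0 : ℝ) < _)⟩
  obtain ⟨ρ, him, hadd, hmul⟩ :=
    exists_conj_roots_of_discrim_neg (P := α) (Q := α ^ 2 + 1) (by nlinarith [sq_nonneg α])
  refine ⟨α, ρ, h1, h2, him, hmul, fun x => ?_⟩
  have h4 : (α : ℂ) ^ 3 + α + 1 = 0 := by exact_mod_cast h3
  push_cast at hmul
  linear_combination (x - α) * x * hadd - (x - α) * hmul + h4

open ComplexConjugate in
/-- The four roots of `x ^ 4 + x ^ 3 + 1` are two conjugate pairs whose squared absolute values
are reciprocal. -/
theorem exists_roots_quartic : ∃ (β : ℝ) (ρ τ : ℂ), 1 < β ∧ β < 3 / 2 ∧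
    β ^ 6 - β ^ 4 - β ^ 3 - β ^ 2 + 1 = 0 ∧ ρ.im ≠ 0 ∧ τ.im ≠ 0 ∧
    ρ * conj ρ = β ∧ τ * conj τ = (β⁻¹ : ℝ) ∧
    ∀ x : ℂ, x ^ 4 + x ^ 3 + 1 = (x - ρ) * (x - conj ρ) * (x - τ) * (x - conj τ) := by
  -- In `x ^ 4 + x ^ 3 + 1 = (x ^ 2 + a x + β) (x ^ 2 + (1 - a) x + 1 / β)` the coefficient of `x`
  -- gives `a = β ^ 2 / (β ^ 2 - 1)`, and that of `x ^ 2` then gives the sextic equation for `β`.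
  have hcont : ContinuousOn (fun x : ℝ => x ^ 6 - x ^ 4 - x ^ 3 - x ^ 2 + 1)
    (Set.Icc 1 (3 / 2)) := by fun_prop
  obtain ⟨β, ⟨h1, h2⟩, h3⟩ :=
    intermediate_value_Ioo (by norm_num : (1 : ℝ) ≤ 3 / 2) hcont ⟨(by norm_num : _ < (0 : ℝ)),
      (by norm_num : (0 : ℝ) < _)⟩
  replace h3 : β ^ 6 - β ^ 4 - β ^ 3 - β ^ 2 + 1 = 0 := h3
  have hβ : 0 < β := by linarith
  have hu : 0 < β ^ 2 - 1 := by nlinarith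
  have h4 : (β ^ 2 + 1) * (β ^ 2 - 1) ^ 2 = β ^ 3 := by linear_combination h3
  have hu2 : 0 < (β ^ 2 - 1) ^ 2 := by positivity
  obtain ⟨ρ, hρ, hρadd, hρmul⟩ := exists_conj_roots_of_discrim_neg
    (P := β ^ 2 / (β ^ 2 - 1)) (Q := β) (by
      rw [div_pow, div_lt_iff₀ hu2]
      have : (β ^ 2 + 1) * (β ^ 2 - 1) ^ 2 < 4 * (β ^ 2 - 1) ^ 2 := by gcongr; nlinarith
      rw [h4] at this
      nlinarith)
  obtain ⟨τ, hτ, hτadd, hτmul⟩ := exists_conj_roots_of_discrim_neg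
    (P := -1 / (β ^ 2 - 1)) (Q := β⁻¹) (by
      rw [div_pow, div_lt_iff₀ hu2, mul_assoc, mul_comm, mul_assoc, ← div_eq_inv_mul,
        lt_div_iff₀' hβ]
      have : (β ^ 2 + 1) * (β ^ 2 - 1) ^ 2 < 4 * β ^ 2 * (β ^ 2 - 1) ^ 2 := by gcongr; nlinarith
      rw [h4] at this
      nlinarith)
  refine ⟨β, ρ, τ, h1, h2, h3, hρ, hτ, hρmul, hτmul, fun x => ?_⟩
  have hq : ∀ z : ℂ, (x - z) * (x - conj z) = x ^ 2 - (z + conj z) * x + z * conj z := fun z => by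
    ring
  have hβC : (β : ℂ) ≠ 0 := by exact_mod_cast hβ.ne'
  have huC : (β : ℂ) ^ 2 - 1 ≠ 0 := by exact_mod_cast hu.ne'
  have h3C : (β : ℂ) ^ 6 - β ^ 4 - β ^ 3 - β ^ 2 + 1 = 0 := by exact_mod_cast h3
  rw [mul_assoc, hq, hq, hρadd, hρmul, hτadd, hτmul]
  push_cast
  field_simp
  linear_combination (-x ^ 2) * h3C

/-! ### The two sets -/

open ComplexConjugate Polynomial in
theorem not_eventuallyPeriodic_sign_two_three :
    ¬ EventuallyPeriodic (fun n : ℕ => SignType.sign (compSum {2, 3} 0 n)) := by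
  intro hper
  obtain ⟨α, ρ, hα1, hα0, hρ, hmul, hroots⟩ := exists_roots_cubic
  have hnorm := norm_sq_eq_of_mul_conj_eq hmul
  have hα : ‖(α : ℂ)‖ < 1 := by
    rw [Complex.norm_real, Real.norm_eq_abs, abs_lt]
    constructor <;> linarith
  have hρ1 : 1 < ‖ρ‖ := by nlinarith [norm_nonneg ρ, mul_pos_of_neg_of_neg hα0 hα0]
  have hab := ne_conj_of_im_ne_zero hρ
  have hac : ρ ≠ α := fun h => hρ (by rw [h, Complex.ofReal_im])
  have hbc : conj ρ ≠ α := fun h => hac (by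
    rw [← Complex.conj_conj ρ, h, Complex.conj_ofReal])
  obtain ⟨p, hp, hpow⟩ := exists_pow_eq_conj_pow_of_sign_periodic
    (c := ((ρ - conj ρ) * (ρ - α))⁻¹ * ρ ^ 2)
    (e := fun n => ((α - ρ) * (α - conj ρ))⁻¹ * (α : ℂ) ^ (n + 2)) hρ
    (by
      have := sub_ne_zero.2 hab
      have := sub_ne_zero.2 hac
      have : ρ ≠ 0 := fun h => hρ (by rw [h, Complex.zero_im])
      positivity)
    (fun n => by
      rw [compSum_two_three_closed_form hab hac hbc hroots]
      simp only [map_mul, map_inv₀, map_sub, map_pow, Complex.conj_conj, Complex.conj_ofReal]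
      ring)
    (summable_norm_div_pow (norm_nonneg (α : ℂ)) (hα.trans hρ1)
      (K := ‖((α - ρ) * (α - conj ρ))⁻¹ * (α : ℂ) ^ 2‖) fun n => by
        rw [← norm_pow, ← norm_mul, pow_add]
        exact le_of_eq (congrArg _ (by ring))) hper
  have hev : ∀ x : ℂ, aeval x (X ^ 3 + X + 1 : ℤ[X]) = (x - ρ) * (x - conj ρ) * (x - α) :=
    fun x => by rw [← hroots]; simp
  have hcases : ∀ x : ℂ, aeval x (X ^ 3 + X + 1 : ℤ[X]) = 0 → x = ρ ∨ x = conj ρ ∨ x = α := by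
    intro x hx
    simpa only [hev, mul_eq_zero, sub_eq_zero, or_assoc] using hx
  have hne : ‖ρ‖ ≠ ‖(α : ℂ)‖ := (hα.trans hρ1).ne'
  obtain ⟨k, hk⟩ := exists_int_eq_aeval_of_pow_eq_conj_pow (f := X ^ 3 + X + 1) (F := X) hp
    (by monicity!) (by rw [hev]; simp) hρ hpow (by
      intro a b ha hb hab' hn
      simp only [aeval_X]
      have hc := Complex.norm_conj ρ
      rcases hcases a ha with rfl | rfl | rfl <;> rcases hcases b hb with rfl | rfl | rfl <;>
        first
        | exact absurd rfl hab'
        | rfl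
        | exact mul_comm _ _
        | (rw [hc] at hn; exact absurd hn hne)
        | (rw [hc] at hn; exact absurd hn.symm hne)
        | exact absurd hn hne
        | exact absurd hn.symm hne)
  rw [aeval_X, hmul] at hk
  have hk' : α ^ 2 + 1 = (k : ℝ) := by exact_mod_cast hk
  have hk1 : (1 : ℝ) < k := by nlinarith
  have hk2 : (k : ℝ) < 2 := by nlinarith
  have hk3 : 1 < k := by exact_mod_cast hk1
  have hk4 : k < 2 := by exact_mod_cast hk2
  omega

open ComplexConjugate Polynomial in
theorem not_eventuallyPeriodic_sign_one_four :
    ¬ EventuallyPeriodic (fun n : ℕ => SignType.sign (compSum {1, 4} 0 n)) := by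
  intro hper
  obtain ⟨β, ρ, τ, hβ1, hβ2, hsextic, hρ, hτ, hρmul, hτmul, hroots⟩ := exists_roots_quartic
  have hβ0 : 0 < β := by linarith
  have hρn := norm_sq_eq_of_mul_conj_eq hρmul
  have hτn := norm_sq_eq_of_mul_conj_eq hτmul
  have hlt : ‖τ‖ < ‖ρ‖ := by
    refine lt_of_pow_lt_pow_left₀ 2 (norm_nonneg _) ?_
    rw [hρn, hτn]
    exact (inv_lt_one_of_one_lt₀ hβ1).trans hβ1
  have hρc := Complex.norm_conj ρ
  have hτc := Complex.norm_conj τ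
  have hab := ne_conj_of_im_ne_zero hρ
  have hcd := ne_conj_of_im_ne_zero hτ
  have hac : ρ ≠ τ := ne_of_apply_ne norm hlt.ne'
  have had : ρ ≠ conj τ := ne_of_apply_ne norm (by rw [hτc]; exact hlt.ne')
  have hbc : conj ρ ≠ τ := ne_of_apply_ne norm (by rw [hρc]; exact hlt.ne')
  have hbd : conj ρ ≠ conj τ := ne_of_apply_ne norm (by rw [hρc, hτc]; exact hlt.ne')
  obtain ⟨p, hp, hpow⟩ := exists_pow_eq_conj_pow_of_sign_periodic
    (c := ((ρ - conj ρ) * (ρ - τ) * (ρ - conj τ))⁻¹ * ρ ^ 3)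
    (e := fun n => ((τ - ρ) * (τ - conj ρ) * (τ - conj τ))⁻¹ * τ ^ 3 * τ ^ n +
      conj (((τ - ρ) * (τ - conj ρ) * (τ - conj τ))⁻¹ * τ ^ 3 * τ ^ n)) hρ
    (by
      have := sub_ne_zero.2 hab
      have := sub_ne_zero.2 hac
      have := sub_ne_zero.2 had
      have : ρ ≠ 0 := fun h => hρ (by rw [h, Complex.zero_im])
      positivity)
    (fun n => by
      rw [compSum_one_four_closed_form hab hac had hbc hbd hcd hroots]
      simp only [map_mul, map_inv₀, map_sub, map_pow, Complex.conj_conj]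
      ring)
    (summable_norm_div_pow (norm_nonneg τ) hlt
      (K := 2 * ‖((τ - ρ) * (τ - conj ρ) * (τ - conj τ))⁻¹ * τ ^ 3‖) fun n => by
        refine (norm_add_le _ _).trans (le_of_eq ?_)
        rw [Complex.norm_conj, norm_mul _ (τ ^ n), norm_pow τ n]
        ring) hper
  have hev : ∀ x : ℂ, aeval x (X ^ 4 + X ^ 3 + 1 : ℤ[X]) =
      (x - ρ) * (x - conj ρ) * (x - τ) * (x - conj τ) := fun x => by rw [← hroots]; simp
  have hcases : ∀ x : ℂ, aeval x (X ^ 4 + X ^ 3 + 1 : ℤ[X]) = 0 →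
      (x = ρ ∨ x = conj ρ) ∨ x = τ ∨ x = conj τ := by
    intro x hx
    simpa only [hev, mul_eq_zero, sub_eq_zero, or_assoc] using hx
  have hpair : ∀ a b : ℂ, aeval a (X ^ 4 + X ^ 3 + 1 : ℤ[X]) = 0 →
      aeval b (X ^ 4 + X ^ 3 + 1 : ℤ[X]) = 0 → a ≠ b → ‖a‖ = ‖b‖ →
      a * b = β ∨ a * b = (β⁻¹ : ℝ) := by
    intro a b ha hb hne hn
    rw [← hρmul, ← hτmul]
    rcases hcases a ha with (rfl | rfl) | rfl | rfl <;>
      rcases hcases b hb with (rfl | rfl) | rfl | rfl <;>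
      first
      | exact absurd rfl hne
      | exact Or.inl rfl
      | exact Or.inr rfl
      | exact Or.inl (mul_comm _ _)
      | exact Or.inr (mul_comm _ _)
      | ((try simp only [hρc, hτc] at hn); exact absurd hn hlt.ne)
      | ((try simp only [hρc, hτc] at hn); exact absurd hn hlt.ne')
  -- By the sextic equation this polynomial takes the value `β + 1 / β` at both `β` and `1 / β`.
  have hF : ∀ x : ℝ, x ≠ 0 → x ^ 6 - x ^ 4 - x ^ 3 - x ^ 2 + 1 = 0 →
      aeval (x : ℂ) (X + X + X ^ 2 + X ^ 3 - X ^ 5 : ℤ[X]) = ((x + x⁻¹ : ℝ) : ℂ) := by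
    intro x hx h
    have h' : x + x + x ^ 2 + x ^ 3 - x ^ 5 = x + x⁻¹ := by
      field_simp
      linear_combination -h
    rw [← h']
    simp
  have hsextic' : β⁻¹ ^ 6 - β⁻¹ ^ 4 - β⁻¹ ^ 3 - β⁻¹ ^ 2 + 1 = 0 := by
    field_simp
    linear_combination hsextic
  obtain ⟨k, hk⟩ := exists_int_eq_aeval_of_pow_eq_conj_pow (f := X ^ 4 + X ^ 3 + 1)
    (F := X + X + X ^ 2 + X ^ 3 - X ^ 5) hp (by monicity!) (by rw [hev]; simp) hρ hpow (by
      intro a b ha hb hne hn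
      rw [hρmul, hF β hβ0.ne' hsextic]
      rcases hpair a b ha hb hne hn with h | h
      · rw [h, hF β hβ0.ne' hsextic]
      · rw [h, hF β⁻¹ (inv_ne_zero hβ0.ne') hsextic', inv_inv, add_comm])
  rw [hρmul, hF β hβ0.ne' hsextic] at hk
  have hk' : β + β⁻¹ = (k : ℝ) := by exact_mod_cast hk
  have hk0 : β ^ 2 + 1 = k * β := by
    rw [← hk']
    field_simp
  have hk1 : (2 : ℝ) < k := by nlinarith [mul_pos (sub_pos.2 hβ1) (sub_pos.2 hβ1)]
  have hk2 : (k : ℝ) < 3 := by nlinarith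
  have hk3 : 2 < k := by exact_mod_cast hk1
  have hk4 : k < 3 := by exact_mod_cast hk2
  omega

theorem mainTheorem4 (A : Set ℕ) (hA : A = {2, 3} ∨ A = {1, 4}) :
    ¬ EventuallyPeriodic (fun n : ℕ => SignType.sign (compSum A 0 n)) := by
  rcases hA with rfl | rfl
  · exact not_eventuallyPeriodic_sign_two_three
  · exact not_eventuallyPeriodic_sign_one_four
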